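/- Let $\mathbb{H}^2=\{z=x+iy\in\mathbb{C} : y>0\}$ and let $(z,w)=(x+iy,\,u+iv)$ be the global coordinates on $\mathbb{H}^2\times\mathbb{C}$. For a smooth function $f$, let $\mathbf{g}_f$ be the symmetric bilinear form whose matrix at $(z,w)$ in the basis $\big(\tfrac{\partial}{\partial x},\tfrac{\partial}{\partial y},\tfrac{\partial}{\partial u},\tfrac{\partial}{\partial v}\big)$ is $$\begin{pmatrix} \frac{1}{y^2}\big(1-f+3(u^2+v^2)y^3f'\big) & 0 & 2f'vy^2 & -2f'uy^2\\ 0 & \frac{1}{y^2}\big(1-f+3(u^2+v^2)y^3f'\big) & 2f'uy^2 & 2f'vy^2\\ 2f'vy^2 & 2f'uy^2 & \frac43 f'y^3 & 0\\ -2f'uy^2 & 2f'vy^2 & 0 & \frac43 f'y^3 \end{pmatrix},$$ where $f$ and $f'$ are evaluated at $y^3(u^2+v^2)$. Take $f(t)=-kt$ with $k>0$, so that $\mathbf{g}_f$ is a pseudo-Riemannian metric of signature $(2,2)$. Let $\mathrm{scal}(\mathbf{g}_f)$ denote its scalar curvature in the normalization $$\mathrm{scal}(\mathbf{g}_f)=\tfrac14\sum_{a,b}\mathbf{g}_f^{ab}\,\mathrm{Ric}_{ab},$$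 one quarter of the real trace of the Ricci tensor $\mathrm{Ric}_{bd}=\sum_a R^a{}_{bad}$ of the Levi-Civita connection (with the sign for which round spheres have positive scalar curvature). Then for every $k>0$: 1. at every point $(z,w)\in\mathbb{H}^2\times\mathbb{C}$ with $w\neq 0$ (in particular at every $(i,u)$ with $u\in\mathbb{C}^*$), $\mathrm{scal}(\mathbf{g}_f)_{(z,w)}<1$; 2. at every point $(z,0)$ of $\mathbb{H}^2\times\{0\}$, $\mathrm{scal}(\mathbf{g}_f)_{(z,0)}=1$. -/

import Mathlib

/-! ### Curvature of a pseudo-Riemannian metric in global coordinates on (an open subset of) `ℝⁿ` -/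

noncomputable section

/-- The partial derivative `∂F/∂xₐ` at the point `p`. -/
def partialDeriv {n : ℕ} (a : Fin n) (F : (Fin n → ℝ) → ℝ) (p : Fin n → ℝ) : ℝ :=
  deriv (fun s : ℝ => F (Function.update p a s)) (p a)

/-- The Christoffel symbol
`Γᵃ_{bc} = ½ ∑_d gᵃᵈ (∂_b g_{dc} + ∂_c g_{bd} - ∂_d g_{bc})` of the Levi-Civita connection of `g`,
where `g p` is the matrix of the metric at `p` in the coordinate basis. -/
def christoffel {n : ℕ} (g : (Fin n → ℝ) → Matrix (Fin n) (Fin n) ℝ) (a b c : Fin n)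
    (p : Fin n → ℝ) : ℝ :=
  (1 / 2 : ℝ) * ∑ d, (g p)⁻¹ a d *
    (partialDeriv b (fun q => g q d c) p + partialDeriv c (fun q => g q b d) p
      - partialDeriv d (fun q => g q b c) p)

/-- The curvature component `Rᵃ_{bcd}`, determined by
`R(∂_c, ∂_d) ∂_b = ∇_c ∇_d ∂_b - ∇_d ∇_c ∂_b = ∑ₐ Rᵃ_{bcd} ∂_a`. -/
def riemannTensor {n : ℕ} (g : (Fin n → ℝ) → Matrix (Fin n) (Fin n) ℝ) (a b c d : Fin n)
    (p : Fin n → ℝ) : ℝ :=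
  partialDeriv c (christoffel g a d b) p - partialDeriv d (christoffel g a c b) p
    + ∑ e, (christoffel g a c e p * christoffel g e d b p
      - christoffel g a d e p * christoffel g e c b p)

/-- The Ricci tensor `Ric_{bd} = ∑ₐ Rᵃ_{bad}` (positive on round spheres). -/
def ricciTensor {n : ℕ} (g : (Fin n → ℝ) → Matrix (Fin n) (Fin n) ℝ) (b d : Fin n)
    (p : Fin n → ℝ) : ℝ :=
  ∑ a, riemannTensor g a b a d p

/-- The Riemannian scalar curvature `∑ gᵇᵈ Ric_{bd}`, i.e. the full real trace of the
Ricci tensor. -/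
def riemannianScalarCurvature {n : ℕ} (g : (Fin n → ℝ) → Matrix (Fin n) (Fin n) ℝ)
    (p : Fin n → ℝ) : ℝ :=
  ∑ b, ∑ d, (g p)⁻¹ b d * ricciTensor g b d p

/-! ### The metrics `g_f` on `ℍ² × ℂ` -/

/-- The metric `g_f` on `ℍ² × ℂ`, as its matrix in the global real coordinates
`p = (x, y, u, v)`, `y > 0`, where `z = x + iy ∈ ℍ²` and `w = u + iv ∈ ℂ`;
`f` and `f'` are evaluated at `y³(u² + v²)`. -/
def metricG (f : ℝ → ℝ) (p : Fin 4 → ℝ) : Matrix (Fin 4) (Fin 4) ℝ :=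
  let y := p 1
  let u := p 2
  let v := p 3
  let t := y ^ 3 * (u ^ 2 + v ^ 2)
  let F := f t
  let F' := deriv f t
  !![1 / y ^ 2 * (1 - F + 3 * (u ^ 2 + v ^ 2) * y ^ 3 * F'), 0,
        2 * F' * v * y ^ 2, -2 * F' * u * y ^ 2;
     0, 1 / y ^ 2 * (1 - F + 3 * (u ^ 2 + v ^ 2) * y ^ 3 * F'),
        2 * F' * u * y ^ 2, 2 * F' * v * y ^ 2;
     2 * F' * v * y ^ 2, 2 * F' * u * y ^ 2, 4 / 3 * F' * y ^ 3, 0;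
     -2 * F' * u * y ^ 2, 2 * F' * v * y ^ 2, 0, 4 / 3 * F' * y ^ 3]

/-- The coordinates `(x, y, u, v)` of the point `(z, w) = (x + iy, u + iv)` of `ℍ² × ℂ`. -/
def realCoords (z : UpperHalfPlane) (w : ℂ) : Fin 4 → ℝ :=
  ![z.re, z.im, w.re, w.im]

/-- The scalar curvature `scal(g_f)` at `(z, w)`, in the following normalization.
The contraction `∑ g^{jk̄} R_{jk̄}` is taken with the inverse matrix of the real metric evaluated on
`∂/∂z_j, ∂/∂z̄_k` (so `g^{zz̄} = ¼ (gˣˣ + gʸʸ)`, a quarter of the usual `g^{zz̄}`) and with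
`R_{jk̄} = -∂_j ∂_k̄ log det g` for the real `4 × 4` determinant (twice `Ric(∂_j, ∂_k̄)`).
As the usual `∑ g^{jk̄} Ric_{jk̄}` is half of the real trace of the Ricci tensor, this is
`¼ · 2 · ½ = ¼` of the Riemannian scalar curvature (the mean of the Ricci eigenvalues). -/
def scalG (f : ℝ → ℝ) (z : UpperHalfPlane) (w : ℂ) : ℝ :=
  (1 / 4 : ℝ) * riemannianScalarCurvature (metricG f) (realCoords z w)

end

/-! For `f(t) = -kt` all entries of the metric are rational in the coordinates, and the curvature
can be computed in closed form. With `P = 1 - f = 1 + k y³|w|²` (`oneSubF`), the normalized scalar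
curvature is exactly `1 / P` (`scalG_linear`). Since `k` and `y` are positive, `P > 1` off `w = 0`
and `P = 1` on it, which gives both claims. The weight is carried by `metricG_inv`,
`christoffel_metricG` and `ricciTensor_metricG`. -/

/-! ### Calculus of partial derivatives -/

/-- The closed forms of the Christoffel symbols are proved only on `y > 0`. That set is open, so
they may still be differentiated there. -/
theorem partialDeriv_congr_of_pos {n : ℕ} {i : Fin n} (a : Fin n) {F G : (Fin n → ℝ) → ℝ}
    {p : Fin n → ℝ} (hp : 0 < p i) (h : ∀ q : Fin n → ℝ, 0 < q i → F q = G q) :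
    partialDeriv a F p = partialDeriv a G p := by
  unfold partialDeriv
  apply Filter.EventuallyEq.deriv_eq
  have hc : Continuous fun s : ℝ => Function.update p a s i := by fun_prop
  have h0 : 0 < Function.update p a (p a) i := by simpa using hp
  filter_upwards [hc.continuousAt.eventually (lt_mem_nhds h0)] with s hs
  exact h _ hs

theorem partialDeriv_neg {n : ℕ} (a : Fin n) (F : (Fin n → ℝ) → ℝ) (p : Fin n → ℝ) :
    partialDeriv a (-F) p = -partialDeriv a F p :=
  deriv.fun_neg

theorem partialDeriv_zero {n : ℕ} (a : Fin n) (p : Fin n → ℝ) :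
    partialDeriv a (0 : (Fin n → ℝ) → ℝ) p = 0 :=
  deriv_const _ _

theorem hasDerivAt_coord {n : ℕ} (p : Fin n → ℝ) (a i : Fin n) :
    HasDerivAt (fun s => Function.update p a s i) (if i = a then 1 else 0) (p a) := by
  rcases eq_or_ne i a with rfl | hi
  · simpa using hasDerivAt_id' (p i)
  · simpa [hi] using hasDerivAt_const (p a) (p i)

/-! ### The metric for `f(t) = -kt`, its inverse and its first derivatives -/

theorem metricG_linear (k : ℝ) (p : Fin 4 → ℝ) :
    metricG (fun t : ℝ => -k * t) p =
      !![(1 - 2 * k * (p 1 ^ 3 * (p 2 ^ 2 + p 3 ^ 2))) / p 1 ^ 2, 0,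
          -(2 * k * p 3 * p 1 ^ 2), 2 * k * p 2 * p 1 ^ 2;
        0, (1 - 2 * k * (p 1 ^ 3 * (p 2 ^ 2 + p 3 ^ 2))) / p 1 ^ 2,
          -(2 * k * p 2 * p 1 ^ 2), -(2 * k * p 3 * p 1 ^ 2);
        -(2 * k * p 3 * p 1 ^ 2), -(2 * k * p 2 * p 1 ^ 2), -(4 / 3 * k * p 1 ^ 3), 0;
        2 * k * p 2 * p 1 ^ 2, -(2 * k * p 3 * p 1 ^ 2), 0, -(4 / 3 * k * p 1 ^ 3)] := by
  ext i j
  fin_cases i <;> fin_cases j <;> simp [metricG] <;> ring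

/-- The function `1 - f(t)` at `t = y³(u² + v²)` for `f(t) = -kt`. -/
noncomputable def oneSubF (k : ℝ) (p : Fin 4 → ℝ) : ℝ := 1 + k * (p 1 ^ 3 * (p 2 ^ 2 + p 3 ^ 2))

theorem oneSubF_pos {k : ℝ} (hk : 0 < k) {p : Fin 4 → ℝ} (hp : 0 < p 1) : 0 < oneSubF k p := by
  unfold oneSubF; positivity

/-- The inverse of the matrix of `g_f` for `f(t) = -kt`. -/
noncomputable def metricInv (k : ℝ) (p : Fin 4 → ℝ) : Matrix (Fin 4) (Fin 4) ℝ :=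
  (oneSubF k p)⁻¹ •
    !![p 1 ^ 2, 0, -(3 / 2 * p 1 * p 3), 3 / 2 * p 1 * p 2;
      0, p 1 ^ 2, -(3 / 2 * p 1 * p 2), -(3 / 2 * p 1 * p 3);
      -(3 / 2 * p 1 * p 3), -(3 / 2 * p 1 * p 2),
        -(3 / 4 * (1 - 2 * k * (p 1 ^ 3 * (p 2 ^ 2 + p 3 ^ 2))) / (k * p 1 ^ 3)), 0;
      3 / 2 * p 1 * p 2, -(3 / 2 * p 1 * p 3), 0,
        -(3 / 4 * (1 - 2 * k * (p 1 ^ 3 * (p 2 ^ 2 + p 3 ^ 2))) / (k * p 1 ^ 3))]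

/-- In 2×2 blocks the diagonal is scalar, `A·1` and `D·1`, and the off-diagonal block `B` satisfies
`B Bᵀ = b·1`. The inverse thus has the single denominator `AD - b = -(4/3) k y P`. -/
theorem metricG_inv {k : ℝ} (hk : 0 < k) {p : Fin 4 → ℝ} (hp : 0 < p 1) :
    (metricG (fun t : ℝ => -k * t) p)⁻¹ = metricInv k p := by
  apply Matrix.inv_eq_right_inv
  have h := (oneSubF_pos hk hp).ne'
  have hk' := hk.ne'
  have hp' := hp.ne'
  rw [metricG_linear, metricInv, Matrix.mul_smul, inv_smul_eq_iff₀ h]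
  ext i j
  fin_cases i <;> fin_cases j <;>
    simp [Matrix.mul_apply, Fin.sum_univ_four, oneSubF] <;> field_simp <;> ring

/-- The matrix of the derivatives of the components of `g_f`, `f(t) = -kt`, in the
direction `a`. -/
noncomputable def metricPartial (k : ℝ) (p : Fin 4 → ℝ) : Fin 4 → Matrix (Fin 4) (Fin 4) ℝ :=
  ![0,
    !![-(2 / p 1 ^ 3) - 2 * k * (p 2 ^ 2 + p 3 ^ 2), 0,
        -(4 * k * p 3 * p 1), 4 * k * p 2 * p 1;
      0, -(2 / p 1 ^ 3) - 2 * k * (p 2 ^ 2 + p 3 ^ 2), -(4 * k * p 2 * p 1), -(4 * k * p 3 * p 1);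
      -(4 * k * p 3 * p 1), -(4 * k * p 2 * p 1), -(4 * k * p 1 ^ 2), 0;
      4 * k * p 2 * p 1, -(4 * k * p 3 * p 1), 0, -(4 * k * p 1 ^ 2)],
    !![-(4 * k * p 1 * p 2), 0, 0, 2 * k * p 1 ^ 2;
      0, -(4 * k * p 1 * p 2), -(2 * k * p 1 ^ 2), 0;
      0, -(2 * k * p 1 ^ 2), 0, 0;
      2 * k * p 1 ^ 2, 0, 0, 0],
    !![-(4 * k * p 1 * p 3), 0, -(2 * k * p 1 ^ 2), 0;
      0, -(4 * k * p 1 * p 3), 0, -(2 * k * p 1 ^ 2);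
      -(2 * k * p 1 ^ 2), 0, 0, 0;
      0, -(2 * k * p 1 ^ 2), 0, 0]]

theorem partialDeriv_metricG (k : ℝ) {p : Fin 4 → ℝ} (hp : 0 < p 1) (a b c : Fin 4) :
    partialDeriv a (fun q => metricG (fun t : ℝ => -k * t) q b c) p = metricPartial k p a b c := by
  have hp' := hp.ne'
  have hc := hasDerivAt_coord p a
  -- Up to sign, these are all the distinct entries of the matrix.
  have e0 : partialDeriv a
      (fun q => (1 - 2 * k * (q 1 ^ 3 * (q 2 ^ 2 + q 3 ^ 2))) / q 1 ^ 2) p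
      = metricPartial k p a 0 0 := by
    refine HasDerivAt.deriv (((((((hc 1).fun_pow 3).fun_mul
      (((hc 2).fun_pow 2).fun_add ((hc 3).fun_pow 2))).const_mul (2 * k)).const_sub 1).fun_div
      ((hc 1).fun_pow 2) (by simpa using hp')).congr_deriv ?_)
    fin_cases a <;> simp [metricPartial] <;> field_simp <;> ring
  have e1 : partialDeriv a (fun q => 2 * k * q 2 * q 1 ^ 2) p = metricPartial k p a 0 3 := by
    refine HasDerivAt.deriv ((((hc 2).const_mul (2 * k)).fun_mul
      ((hc 1).fun_pow 2)).congr_deriv ?_)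
    fin_cases a <;> simp [metricPartial]
    all_goals ring
  have e2 : partialDeriv a (fun q => -(2 * k * q 3 * q 1 ^ 2)) p = metricPartial k p a 0 2 := by
    refine HasDerivAt.deriv ((((hc 3).const_mul (2 * k)).fun_mul
      ((hc 1).fun_pow 2)).fun_neg.congr_deriv ?_)
    fin_cases a <;> simp [metricPartial]
    all_goals ring
  have e3 : partialDeriv a (fun q => -(4 / 3 * k * q 1 ^ 3)) p = metricPartial k p a 2 2 := by
    refine HasDerivAt.deriv ((((hc 1).fun_pow 3).const_mul (4 / 3 * k)).fun_neg.congr_deriv ?_)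
    fin_cases a <;> simp [metricPartial]
    all_goals ring
  have e4 : partialDeriv a (fun q => -(2 * k * q 2 * q 1 ^ 2)) p
      = -metricPartial k p a 0 3 := by
    rw [← e1]; exact partialDeriv_neg a _ p
  have e5 : partialDeriv a (fun _ => (0 : ℝ)) p = 0 := partialDeriv_zero a p
  simp only [metricG_linear]
  fin_cases b <;> fin_cases c <;> simp [e0, e1, e2, e3, e4, e5] <;>
    fin_cases a <;> simp [metricPartial]

/-! ### The Christoffel symbols -/

/-- The Christoffel symbol `Γˣ_{xy}` for `f(t) = -kt`. -/
noncomputable def gammaXY (k : ℝ) (p : Fin 4 → ℝ) : ℝ := (2 - 3 * (oneSubF k p)⁻¹) * (p 1)⁻¹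

/-- The Christoffel symbol `Γˣ_{xu}` for `f(t) = -kt`. -/
noncomputable def gammaXU (k : ℝ) (p : Fin 4 → ℝ) : ℝ := k * p 1 ^ 3 * p 2 * (oneSubF k p)⁻¹

/-- The Christoffel symbol `Γˣ_{xv}` for `f(t) = -kt`. -/
noncomputable def gammaXV (k : ℝ) (p : Fin 4 → ℝ) : ℝ := k * p 1 ^ 3 * p 3 * (oneSubF k p)⁻¹

/-- The Christoffel symbol `Γᵘ_{xx}` for `f(t) = -kt`. -/
noncomputable def gammaUXX (k : ℝ) (p : Fin 4 → ℝ) : ℝ :=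
  3 / 2 * p 2 * ((1 - 3 * (oneSubF k p)⁻¹) * ((p 1)⁻¹) ^ 2)

/-- The Christoffel symbol `Γᵛ_{xx}` for `f(t) = -kt`. -/
noncomputable def gammaVXX (k : ℝ) (p : Fin 4 → ℝ) : ℝ :=
  3 / 2 * p 3 * ((1 - 3 * (oneSubF k p)⁻¹) * ((p 1)⁻¹) ^ 2)

/-- The Christoffel symbol `Γᵘ_{xv}` for `f(t) = -kt`. -/
noncomputable def gammaUXV (k : ℝ) (p : Fin 4 → ℝ) : ℝ := 3 / 2 * ((oneSubF k p)⁻¹ * (p 1)⁻¹)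

/-- The Christoffel symbols `Γᵃ_{bc}` of `g_f` for `f(t) = -kt`. -/
noncomputable def gammaTable (k : ℝ) : Fin 4 → Fin 4 → Fin 4 → (Fin 4 → ℝ) → ℝ :=
  ![![![0, gammaXY k, gammaXU k, gammaXV k], ![gammaXY k, 0, gammaXV k, -gammaXU k],
      ![gammaXU k, gammaXV k, 0, 0], ![gammaXV k, -gammaXU k, 0, 0]],
    ![![-gammaXY k, 0, -gammaXV k, gammaXU k], ![0, gammaXY k, gammaXU k, gammaXV k],
      ![-gammaXV k, gammaXU k, 0, 0], ![gammaXU k, gammaXV k, 0, 0]],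
    ![![gammaUXX k, -gammaVXX k, 0, gammaUXV k], ![-gammaVXX k, -gammaUXX k, gammaUXV k, 0],
      ![0, gammaUXV k, 0, 0], ![gammaUXV k, 0, 0, 0]],
    ![![gammaVXX k, gammaUXX k, -gammaUXV k, 0], ![gammaUXX k, -gammaVXX k, 0, gammaUXV k],
      ![-gammaUXV k, 0, 0, 0], ![0, gammaUXV k, 0, 0]]]

-- The metric is Kähler for the standard complex structure, so the symbols are the real and
-- imaginary parts of `Γᶻ_zz`, `Γᶻ_zw`, `Γʷ_zz`, `Γʷ_zw`, those with lower indices `ww` being zero.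
-- Hence six functions, up to sign, fill the table.
set_option maxHeartbeats 4000000 in
theorem christoffel_metricG {k : ℝ} (hk : 0 < k) {p : Fin 4 → ℝ} (hp : 0 < p 1)
    (a b c : Fin 4) :
    christoffel (metricG fun t : ℝ => -k * t) a b c p = gammaTable k a b c p := by
  have h := (oneSubF_pos hk hp).ne'
  have hk' := hk.ne'
  have hp' := hp.ne'
  simp only [christoffel, metricG_inv hk hp, partialDeriv_metricG k hp, Fin.sum_univ_four]
  unfold oneSubF at h
  fin_cases a <;> fin_cases b <;> fin_cases c <;>
    simp [-mul_eq_zero, metricInv, metricPartial, gammaTable, gammaXY, gammaXU, gammaXV, gammaUXX, gammaVXX,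
      gammaUXV, oneSubF] <;> field_simp <;> ring

/-- The partial derivatives of `(1 - f)⁻¹` for `f(t) = -kt`. -/
noncomputable def oneSubFInvPartial (k : ℝ) (p : Fin 4 → ℝ) (a : Fin 4) : ℝ :=
  -(k * ![0, 3 * p 1 ^ 2 * (p 2 ^ 2 + p 3 ^ 2), 2 * p 1 ^ 3 * p 2, 2 * p 1 ^ 3 * p 3] a)
    / oneSubF k p ^ 2

/-- Every Christoffel symbol is a polynomial in the coordinates, `P⁻¹` and `y⁻¹`, so the product
rule reduces its derivatives to those of these factors. -/
theorem hasDerivAt_oneSubF_inv {k : ℝ} (hk : 0 < k) {p : Fin 4 → ℝ} (hp : 0 < p 1) (a : Fin 4) :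
    HasDerivAt (fun s => (oneSubF k (Function.update p a s))⁻¹) (oneSubFInvPartial k p a)
      (p a) := by
  have h := (oneSubF_pos hk hp).ne'
  have hc := hasDerivAt_coord p a
  refine HasDerivAt.congr_deriv (HasDerivAt.fun_inv (((((hc 1).fun_pow 3).fun_mul
      (((hc 2).fun_pow 2).fun_add ((hc 3).fun_pow 2))).const_mul k).const_add 1)
      (by simpa [oneSubF] using h)) ?_
  unfold oneSubFInvPartial
  congr 1
  · fin_cases a <;> simp [-mul_eq_mul_left_iff]
    all_goals ring
  · simp [oneSubF]

theorem hasDerivAt_y_inv {p : Fin 4 → ℝ} (hp : 0 < p 1) (a : Fin 4) :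
    HasDerivAt (fun s => (Function.update p a s 1)⁻¹) (![0, -1 / p 1 ^ 2, 0, 0] a) (p a) := by
  refine ((hasDerivAt_coord p a 1).fun_inv (by simpa using hp.ne')).congr_deriv ?_
  fin_cases a <;> simp

theorem partialDeriv_gammaXY {k : ℝ} (hk : 0 < k) {p : Fin 4 → ℝ} (hp : 0 < p 1)
    (a : Fin 4) :
    partialDeriv a (gammaXY k) p = -(3 * oneSubFInvPartial k p a) * (p 1)⁻¹ +
      (2 - 3 * (oneSubF k p)⁻¹) * ![0, -1 / p 1 ^ 2, 0, 0] a := by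
  refine HasDerivAt.deriv (((((hasDerivAt_oneSubF_inv hk hp a).const_mul 3).const_sub 2).fun_mul
    (hasDerivAt_y_inv hp a)).congr_deriv ?_)
  simp

theorem partialDeriv_gammaXU {k : ℝ} (hk : 0 < k) {p : Fin 4 → ℝ} (hp : 0 < p 1)
    (a : Fin 4) :
    partialDeriv a (gammaXU k) p =
      ![0, 3 * k * p 1 ^ 2 * p 2, k * p 1 ^ 3, 0] a * (oneSubF k p)⁻¹ +
        k * p 1 ^ 3 * p 2 * oneSubFInvPartial k p a := by
  have hc := hasDerivAt_coord p a
  refine HasDerivAt.deriv ((((((hc 1).fun_pow 3).const_mul k).fun_mul (hc 2)).fun_mul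
    (hasDerivAt_oneSubF_inv hk hp a)).congr_deriv ?_)
  congr 2
  · fin_cases a <;> simp [-mul_eq_mul_right_iff]
    all_goals ring
  · simp
  · simp

theorem partialDeriv_gammaXV {k : ℝ} (hk : 0 < k) {p : Fin 4 → ℝ} (hp : 0 < p 1)
    (a : Fin 4) :
    partialDeriv a (gammaXV k) p =
      ![0, 3 * k * p 1 ^ 2 * p 3, 0, k * p 1 ^ 3] a * (oneSubF k p)⁻¹ +
        k * p 1 ^ 3 * p 3 * oneSubFInvPartial k p a := by
  have hc := hasDerivAt_coord p a
  refine HasDerivAt.deriv ((((((hc 1).fun_pow 3).const_mul k).fun_mul (hc 3)).fun_mul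
    (hasDerivAt_oneSubF_inv hk hp a)).congr_deriv ?_)
  congr 2
  · fin_cases a <;> simp [-mul_eq_mul_right_iff]
    all_goals ring
  · simp
  · simp

/-- The partial derivatives of `(1 - 3(1 - f)⁻¹) y⁻²` for `f(t) = -kt`. -/
noncomputable def gammaFactorPartial (k : ℝ) (p : Fin 4 → ℝ) (a : Fin 4) : ℝ :=
  -(3 * oneSubFInvPartial k p a) * (p 1)⁻¹ ^ 2 +
    (1 - 3 * (oneSubF k p)⁻¹) * ![0, -2 / p 1 ^ 3, 0, 0] a

theorem hasDerivAt_gammaFactor {k : ℝ} (hk : 0 < k) {p : Fin 4 → ℝ} (hp : 0 < p 1) (a : Fin 4) :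
    HasDerivAt (fun s => (1 - 3 * (oneSubF k (Function.update p a s))⁻¹) *
      ((Function.update p a s 1)⁻¹) ^ 2) (gammaFactorPartial k p a) (p a) := by
  refine ((((hasDerivAt_oneSubF_inv hk hp a).const_mul 3).const_sub 1).fun_mul
    ((hasDerivAt_y_inv hp a).fun_pow 2)).congr_deriv ?_
  unfold gammaFactorPartial
  congr 2
  · simp
  · simp
  · fin_cases a <;> simp
    field_simp

theorem partialDeriv_gammaUXX {k : ℝ} (hk : 0 < k) {p : Fin 4 → ℝ} (hp : 0 < p 1)
    (a : Fin 4) :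
    partialDeriv a (gammaUXX k) p =
      3 / 2 * ![0, 0, 1, 0] a * ((1 - 3 * (oneSubF k p)⁻¹) * ((p 1)⁻¹) ^ 2) +
        3 / 2 * p 2 * gammaFactorPartial k p a := by
  refine HasDerivAt.deriv ((((hasDerivAt_coord p a 2).const_mul (3 / 2)).fun_mul
    (hasDerivAt_gammaFactor hk hp a)).congr_deriv ?_)
  fin_cases a <;> simp

theorem partialDeriv_gammaVXX {k : ℝ} (hk : 0 < k) {p : Fin 4 → ℝ} (hp : 0 < p 1)
    (a : Fin 4) :
    partialDeriv a (gammaVXX k) p =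
      3 / 2 * ![0, 0, 0, 1] a * ((1 - 3 * (oneSubF k p)⁻¹) * ((p 1)⁻¹) ^ 2) +
        3 / 2 * p 3 * gammaFactorPartial k p a := by
  refine HasDerivAt.deriv ((((hasDerivAt_coord p a 3).const_mul (3 / 2)).fun_mul
    (hasDerivAt_gammaFactor hk hp a)).congr_deriv ?_)
  fin_cases a <;> simp

theorem partialDeriv_gammaUXV {k : ℝ} (hk : 0 < k) {p : Fin 4 → ℝ} (hp : 0 < p 1)
    (a : Fin 4) :
    partialDeriv a (gammaUXV k) p =
      3 / 2 * (oneSubFInvPartial k p a * (p 1)⁻¹ +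
        (oneSubF k p)⁻¹ * ![0, -1 / p 1 ^ 2, 0, 0] a) := by
  refine HasDerivAt.deriv ((((hasDerivAt_oneSubF_inv hk hp a).fun_mul
    (hasDerivAt_y_inv hp a)).const_mul (3 / 2)).congr_deriv ?_)
  simp

/-! ### The Ricci tensor and the scalar curvature -/

/-- The Ricci tensor of `g_f` for `f(t) = -kt`. -/
noncomputable def ricciTable (k : ℝ) (p : Fin 4 → ℝ) : Matrix (Fin 4) (Fin 4) ℝ :=
  let α := (9 / 2 - 6 * oneSubF k p + 2 * oneSubF k p ^ 2) / p 1 ^ 2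
  ((oneSubF k p) ^ 2)⁻¹ •
    !![α, 0, -(3 * k * p 1 ^ 2 * p 3), 3 * k * p 1 ^ 2 * p 2;
      0, α, -(3 * k * p 1 ^ 2 * p 2), -(3 * k * p 1 ^ 2 * p 3);
      -(3 * k * p 1 ^ 2 * p 3), -(3 * k * p 1 ^ 2 * p 2), -(2 * k * p 1 ^ 3), 0;
      3 * k * p 1 ^ 2 * p 2, -(3 * k * p 1 ^ 2 * p 3), 0, -(2 * k * p 1 ^ 3)]

theorem partialDeriv_christoffel_metricG {k : ℝ} (hk : 0 < k) {p : Fin 4 → ℝ} (hp : 0 < p 1)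
    (a b c d : Fin 4) :
    partialDeriv d (christoffel (metricG fun t : ℝ => -k * t) a b c) p =
      partialDeriv d (gammaTable k a b c) p :=
  partialDeriv_congr_of_pos d hp fun _ hq => christoffel_metricG hk hq a b c

-- The table is what the Kähler formula `-∂∂̄ log det` predicts, the complex determinant being a
-- constant times `y P`. The proof expands the definition instead.
set_option maxHeartbeats 8000000 in
theorem ricciTensor_metricG {k : ℝ} (hk : 0 < k) {p : Fin 4 → ℝ} (hp : 0 < p 1) (b d : Fin 4) :
    ricciTensor (metricG fun t : ℝ => -k * t) b d p = ricciTable k p b d := by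
  have h := (oneSubF_pos hk hp).ne'
  have hk' := hk.ne'
  have hp' := hp.ne'
  simp only [ricciTensor, riemannTensor, christoffel_metricG hk hp,
    partialDeriv_christoffel_metricG hk hp, Fin.sum_univ_four]
  unfold oneSubF at h
  fin_cases b <;> fin_cases d <;>
    simp [-mul_eq_zero, gammaTable, partialDeriv_zero, partialDeriv_neg, partialDeriv_gammaXY hk hp,
      partialDeriv_gammaXU hk hp, partialDeriv_gammaXV hk hp, partialDeriv_gammaUXX hk hp,
      partialDeriv_gammaVXX hk hp, partialDeriv_gammaUXV hk hp, gammaFactorPartial,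
      oneSubFInvPartial, gammaXY, gammaXU, gammaXV, gammaUXX, gammaVXX, gammaUXV, ricciTable,
      oneSubF] <;> field_simp <;> ring

/-- The full trace of the Ricci tensor of `g_f` for `f(t) = -kt` is `4 / (1 + k y³ |w|²)`. -/
theorem riemannianScalarCurvature_metricG {k : ℝ} (hk : 0 < k) {p : Fin 4 → ℝ} (hp : 0 < p 1) :
    riemannianScalarCurvature (metricG fun t : ℝ => -k * t) p = 4 / oneSubF k p := by
  have h := (oneSubF_pos hk hp).ne'
  have hk' := hk.ne'
  have hp' := hp.ne'
  simp only [riemannianScalarCurvature, metricG_inv hk hp, ricciTensor_metricG hk hp,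
    Fin.sum_univ_four]
  unfold oneSubF at h
  simp [metricInv, ricciTable, oneSubF]
  field_simp
  ring

theorem scalG_linear {k : ℝ} (hk : 0 < k) (z : UpperHalfPlane) (w : ℂ) :
    scalG (fun t : ℝ => -k * t) z w = 1 / (1 + k * (z.im ^ 3 * (w.re ^ 2 + w.im ^ 2))) := by
  have hp : 0 < realCoords z w 1 := z.im_pos
  rw [scalG, riemannianScalarCurvature_metricG hk hp]
  simp [oneSubF, realCoords]
  ring

theorem mainTheorem9 (k : ℝ) (hk : 0 < k) :
    (∀ (z : UpperHalfPlane) (w : ℂ), w ≠ 0 → scalG (fun t : ℝ => -k * t) z w < 1) ∧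
    (∀ z : UpperHalfPlane, scalG (fun t : ℝ => -k * t) z 0 = 1) := by
  refine ⟨fun z w hw => ?_, fun z => by rw [scalG_linear hk]; simp⟩
  have hw' : 0 < w.re ^ 2 + w.im ^ 2 := by
    simpa [Complex.normSq_apply, sq] using Complex.normSq_pos.mpr hw
  have hz := z.im_pos
  rw [scalG_linear hk, div_lt_one (by positivity)]
  have : 0 < k * (z.im ^ 3 * (w.re ^ 2 + w.im ^ 2)) := by positivity
  linarith
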